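/- Let $n\ge 1$ and $\beta>0$, and let $\mathbb D=\{z\in\mathbb C:|z|<1\}$. Let $\alpha_0,\dots,\alpha_{n-1}$ be independent complex random variables such that, for $0\le k\le n-1$, $\alpha_k$ is $\Theta(\beta(k+1)+1)$-distributed, that is, $\alpha_k$ is distributed in $\mathbb D$ with the law $$\frac{\beta(k+1)}{2\pi}\,(1-|\alpha_k|^2)^{\frac{\beta}{2}(k+1)-1}\,d^2\alpha_k ,$$ where $d^2$ is two-dimensional Lebesgue measure. Put $\rho_k=\sqrt{1-|\alpha_k|^2}$, $\Xi_{-1}=[1]$, $\Xi_k=\begin{bmatrix}\bar\alpha_k&\rho_k\\ \rho_k&-\alpha_k\end{bmatrix}$ for $0\le k\le n-2$ and $\Xi_{n-1}=[\bar\alpha_{n-1}]$, and let $\mathcal C(\alpha_0,\dots,\alpha_{n-1})=\mathcal L\mathcal M$ be the $n\times n$ (cut-off) CMV matrix, where $\mathcal L=\operatorname{diag}(\Xi_0,\Xi_2,\Xi_4,\dots)$ and $\mathcal M=\operatorname{diag}(\Xi_{-1},\Xi_1,\Xi_3,\dots)$. Then the eigenvalues $z_1,\dots,z_n$ of $\mathcal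 C(\alpha_0,\dots,\alpha_{n-1})$, counted with algebraic multiplicity and without ordering, are distributed in $\mathbb D^n$ with the joint law $$\frac{\beta^n}{(2\pi)^n}\prod_{j,k=1}^n(1-z_j\bar z_k)^{\frac{\beta}{2}-1}\prod_{1\le j<k\le n}|z_k-z_j|^2\,d^2z_1\cdots d^2z_n .$$ That is, this symmetric measure $\nu$ on $\mathbb D^n$ satisfies $\mathbb E[F(z_1,\dots,z_n)]=\int_{\mathbb D^n}F\,d\nu$ for every symmetric Borel function $F:\mathbb C^n\to[0,\infty]$. -/

import Mathlib

open MeasureTheory ProbabilityTheory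
open scoped ENNReal ComplexConjugate

noncomputable section

namespace CutoffCMV

/-- The law `Θ(ν)` on the open unit disk of `ℂ`, for `ν > 1`: it has density
`(ν - 1) / (2π) * (1 - |z|²) ^ ((ν - 3) / 2)` with respect to the two-dimensional Lebesgue
measure on the disk. -/
def thetaLaw (ν : ℝ) : Measure ℂ :=
  (volume.restrict (Metric.ball (0 : ℂ) 1)).withDensity fun z =>
    ENNReal.ofReal ((ν - 1) / (2 * Real.pi) * (1 - ‖z‖ ^ 2) ^ ((ν - 3) / 2))

/-- The `2 × 2` block `Ξ` with rows `(conj a, ρ)` and `(ρ, -a)`, where `ρ = √(1 - |a|²)`. -/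
def xi (a : ℂ) : Matrix (Fin 2) (Fin 2) ℂ :=
  !![conj a, (Real.sqrt (1 - ‖a‖ ^ 2) : ℂ);
     (Real.sqrt (1 - ‖a‖ ^ 2) : ℂ), -a]

/-- `𝓛 = diag(Ξ₀, Ξ₂, Ξ₄, …)`, cut to size `n × n`. The block `Ξ_k`, `k` even, occupies rows and
columns `k, k + 1`; for `k = n - 1` only its upper left entry `conj α_{n-1}` is left. -/
def cmvL {n : ℕ} (α : Fin n → ℂ) : Matrix (Fin n) (Fin n) ℂ :=
  Matrix.of fun i j =>
    if (i : ℕ) / 2 = (j : ℕ) / 2 then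
      xi (α ⟨2 * ((i : ℕ) / 2), by omega⟩)
        ⟨(i : ℕ) % 2, by omega⟩ ⟨(j : ℕ) % 2, by omega⟩
    else 0

/-- `𝓜 = diag(Ξ₋₁, Ξ₁, Ξ₃, …)` with `Ξ₋₁ = [1]`, cut to size `n × n`. The block `Ξ_k`, `k` odd,
occupies rows and columns `k, k + 1`; for `k = n - 1` only its upper left entry `conj α_{n-1}`
is left. -/
def cmvM {n : ℕ} (α : Fin n → ℂ) : Matrix (Fin n) (Fin n) ℂ :=
  Matrix.of fun i j =>
    if ((i : ℕ) + 1) / 2 = ((j : ℕ) + 1) / 2 then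
      if (i : ℕ) = 0 then 1
      else
        xi (α ⟨2 * (((i : ℕ) + 1) / 2) - 1, by omega⟩)
          ⟨((i : ℕ) + 1) % 2, by omega⟩ ⟨((j : ℕ) + 1) % 2, by omega⟩
    else 0

/-- The (cut-off) CMV matrix `𝓒(α₀, …, α_{n-1}) = 𝓛 𝓜`. -/
def cmv {n : ℕ} (α : Fin n → ℂ) : Matrix (Fin n) (Fin n) ℂ :=
  cmvL α * cmvM α

/-- The complex number `∏_{j,k} (1 - z_j conj z_k) ^ (β/2 - 1)` (principal powers; the bases have
positive real part when all `z_j` lie in the open unit disk). -/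
def interaction {n : ℕ} (β : ℝ) (z : Fin n → ℂ) : ℂ :=
  ∏ j, ∏ k, (1 - z j * conj (z k)) ^ ((β / 2 - 1 : ℝ) : ℂ)

/-- `β^n / (2π)^n * ∏_{j,k} (1 - z_j conj z_k) ^ (β/2 - 1) * ∏_{j<k} |z_k - z_j|²`.
The first product is a positive real number for `z` in the open polydisk
(`interaction_eq_ofReal`), so that taking its real part loses nothing. -/
def jointDensity (n : ℕ) (β : ℝ) (z : Fin n → ℂ) : ℝ :=
  β ^ n / (2 * Real.pi) ^ n * (interaction β z).re *
    ∏ j, ∏ k ∈ Finset.Ioi j, ‖z k - z j‖ ^ 2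

/-- The measure on `ℂⁿ` carried by `𝔻ⁿ` with density `jointDensity n β` with respect to
`d²z₁ ⋯ d²z_n`. -/
def jointLaw (n : ℕ) (β : ℝ) : Measure (Fin n → ℂ) :=
  (volume.restrict {z : Fin n → ℂ | ∀ i, ‖z i‖ < 1}).withDensity fun z =>
    ENNReal.ofReal (jointDensity n β z)

/-- The (unordered) eigenvalues of the random `n × n` matrix `A`, counted with algebraic
multiplicity, have the joint law `ν` on `ℂⁿ`: `ν` is invariant under permutations of the
coordinates, and `E[F(z₁, …, z_n)] = ∫ F dν` for every symmetric nonnegative Borel function `F`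
of `n` complex variables, where `z₁, …, z_n` are the eigenvalues. Symmetric functions are written
as functions of multisets. -/
def HasJointEigenvalueLaw {Ω : Type*} [MeasurableSpace Ω] {n : ℕ} (P : Measure Ω)
    (A : Ω → Matrix (Fin n) (Fin n) ℂ) (ν : Measure (Fin n → ℂ)) : Prop :=
  (∀ σ : Equiv.Perm (Fin n), ν.map (fun z => z ∘ σ) = ν) ∧
  ∀ F : Multiset ℂ → ℝ≥0∞,
    Measurable (fun z : Fin n → ℂ => F (Finset.univ.val.map z)) →
    AEMeasurable (fun ω => F (A ω).charpoly.roots) P ∧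
    ∫⁻ ω, F (A ω).charpoly.roots ∂P =
      ∫⁻ z : Fin n → ℂ, F (Finset.univ.val.map z) ∂ν

/-- On the open polydisk the complex product is the positive real number
`∏_{j,k} |1 - z_j conj z_k| ^ (β/2 - 1)`. -/
theorem interaction_eq_ofReal {n : ℕ} (β : ℝ) (z : Fin n → ℂ) (hz : ∀ i, ‖z i‖ < 1) :
    interaction β z = ((∏ j, ∏ k, ‖1 - z j * conj (z k)‖ ^ (β / 2 - 1) : ℝ) : ℂ) ∧
      0 < ∏ j, ∏ k, ‖1 - z j * conj (z k)‖ ^ (β / 2 - 1) := by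
  have hlt : ∀ j k, ‖z j * conj (z k)‖ < 1 := fun j k => by
    rw [norm_mul, RCLike.norm_conj]
    have h1 := hz j
    have h2 := hz k
    nlinarith [norm_nonneg (z j), norm_nonneg (z k)]
  have hre : ∀ j k, 0 < (1 - z j * conj (z k)).re := fun j k => by
    have := (Complex.re_le_norm (z j * conj (z k))).trans_lt (hlt j k)
    rw [Complex.sub_re, Complex.one_re]
    linarith
  have hne : ∀ j k, 1 - z j * conj (z k) ≠ 0 := fun j k h => by
    have := hre j k
    rw [h] at this
    simp at this
  have hnorm : ‖interaction β z‖ = ∏ j, ∏ k, ‖1 - z j * conj (z k)‖ ^ (β / 2 - 1) := by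
    rw [interaction, norm_prod]
    refine Finset.prod_congr rfl fun j _ => ?_
    rw [norm_prod]
    refine Finset.prod_congr rfl fun k _ => ?_
    exact Complex.norm_cpow_real _ _
  have hpos : 0 < ∏ j, ∏ k, ‖1 - z j * conj (z k)‖ ^ (β / 2 - 1) :=
    Finset.prod_pos fun j _ => Finset.prod_pos fun k _ =>
      Real.rpow_pos_of_pos (norm_pos_iff.2 (hne j k)) _
  refine ⟨?_, hpos⟩
  have hexp : interaction β z =
      Complex.exp (∑ j, ∑ k, Complex.log (1 - z j * conj (z k)) * ((β / 2 - 1 : ℝ) : ℂ)) := by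
    rw [interaction, Complex.exp_sum]
    refine Finset.prod_congr rfl fun j _ => ?_
    rw [Complex.exp_sum]
    refine Finset.prod_congr rfl fun k _ => ?_
    rw [Complex.cpow_def_of_ne_zero (hne j k)]
  have hconj : conj (∑ j, ∑ k, Complex.log (1 - z j * conj (z k)) * ((β / 2 - 1 : ℝ) : ℂ)) =
      ∑ j, ∑ k, Complex.log (1 - z j * conj (z k)) * ((β / 2 - 1 : ℝ) : ℂ) := by
    conv_lhs => rw [Finset.sum_comm]
    simp only [map_sum, map_mul, Complex.conj_ofReal]
    refine Finset.sum_congr rfl fun j _ => Finset.sum_congr rfl fun k _ => ?_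
    rw [← Complex.log_conj]
    · congr 2
      simp [mul_comm]
    · intro h
      have h2 := Complex.arg_eq_pi_iff.1 h
      have h3 := hre k j
      linarith [h2.1]
  obtain ⟨r, hr⟩ := Complex.conj_eq_iff_real.1 hconj
  rw [← hnorm, hexp, hr, ← Complex.ofReal_exp, Complex.norm_real, Real.norm_eq_abs,
    abs_of_pos (Real.exp_pos r)]

end CutoffCMV

end

/-! ### Szegő recursion, roots in the disk, and the pair energy of the roots. -/

noncomputable section

namespace CutoffCMV

open Polynomial

/-! The characteristic polynomial of the CMV matrix is the monic orthogonal polynomial Φ_n of the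
Szegő recursion Φ_{k+1} = XΦ_k - conj(α_k)Φ_k^* (`charpoly_cmv`). So the law of the α_k is first
pushed to the coefficients of Φ_n, then to its roots.

Two facts make the first push explicit. For fixed a = α_k, the step on the k lower coefficients is
real-linear with Jacobian (1-|a|²)^k (`abs_det_one_sub_revConj`). The energy E = ∏_{j,l}|1 - z_j
conj(z_l)| over the roots is multiplied by (1-|a|²)^{k+1} (`pairEnergy_szegoStep`). The exponent of
Θ(β(k+1)+1) is exactly k + (k+1)(β/2-1), so by induction the coefficients have density ∏_{k<n}
β(k+1)/(2π) · E^{β/2-1} on the polynomials with all roots in the disk (`lintegral_szegoCoeff`).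

The passage from roots to coefficients has real Jacobian |Vandermonde|² and is n!-to-one off a null
set (`lintegral_roots`). This n! cancels the one contained in ∏(k+1), which leaves the stated law.
-/

/-- The monic polynomial `X ^ n + ∑ i, c i * X ^ i`. -/
def monicPoly {n : ℕ} (c : Fin n → ℂ) : ℂ[X] :=
  X ^ n + ∑ i : Fin n, C (c i) * X ^ (i : ℕ)

/-- The reversed conjugate polynomial `x ^ n * conj (p (1 / conj x))` of `p = monicPoly c`. -/
def reversedPoly {n : ℕ} (c : Fin n → ℂ) : ℂ[X] :=
  1 + ∑ i : Fin n, C (conj (c i.rev)) * X ^ ((i : ℕ) + 1)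

/-- One step of the Szegő recursion on the non-leading coefficients. -/
def szegoStep {n : ℕ} (a : ℂ) (c : Fin n → ℂ) : Fin (n + 1) → ℂ :=
  Fin.cons (-conj a) fun i => c i - conj a * conj (c i.rev)

/-- The coefficients of the monic orthogonal polynomial with Verblunsky coefficients `α`. -/
def szegoCoeff : {n : ℕ} → (Fin n → ℂ) → Fin n → ℂ
  | 0, α => α
  | _ + 1, α => szegoStep (α (Fin.last _)) (szegoCoeff (Fin.init α))

/-- All roots lie in the open unit disk. -/
def IsDiskStable {n : ℕ} (c : Fin n → ℂ) : Prop :=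
  ∀ x : ℂ, 1 ≤ ‖x‖ → (monicPoly c).eval x ≠ 0

/-- The product of `‖1 - z * conj w‖` over all pairs of elements of a multiset. -/
def pairEnergy (s : Multiset ℂ) : ℝ :=
  (s.map fun z => (s.map fun w => ‖1 - z * conj w‖).prod).prod

variable {n : ℕ}

theorem monicPoly_szegoStep (a : ℂ) (c : Fin n → ℂ) :
    monicPoly (szegoStep a c) = X * monicPoly c - C (conj a) * reversedPoly c := by
  simp only [monicPoly, reversedPoly, szegoStep, Fin.sum_univ_succ, Fin.cons_zero, Fin.cons_succ,
    Fin.val_succ, Fin.val_zero, map_sub, map_mul, map_neg, sub_mul, Finset.sum_sub_distrib,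
    mul_add, Finset.mul_sum]
  have h1 : ∀ i : Fin n, C (c i) * (X : ℂ[X]) ^ ((i : ℕ) + 1) = X * (C (c i) * X ^ (i : ℕ)) :=
    fun i => by ring
  simp only [h1, mul_assoc]
  ring

theorem reversedPoly_szegoStep (a : ℂ) (c : Fin n → ℂ) :
    reversedPoly (szegoStep a c) = reversedPoly c - C a * (X * monicPoly c) := by
  have h1 : ∀ i : Fin n, C a * C (c i) * (X : ℂ[X]) ^ ((i : ℕ) + 1) =
      C a * (X * (C (c i) * X ^ (i : ℕ))) := fun i => by ring
  simp only [monicPoly, reversedPoly, szegoStep, Fin.sum_univ_castSucc, Fin.rev_castSucc,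
    Fin.rev_last, Fin.cons_zero, Fin.cons_succ, Fin.val_castSucc, Fin.val_last, map_sub, map_mul,
    map_neg, Complex.conj_conj, Fin.rev_rev, sub_mul, Finset.sum_sub_distrib, mul_add,
    Finset.mul_sum, h1]
  ring

theorem eval_reversedPoly (c : Fin n → ℂ) {x : ℂ} (hx : x ≠ 0) :
    (reversedPoly c).eval x = x ^ n * conj ((monicPoly c).eval (conj x)⁻¹) := by
  simp only [reversedPoly, monicPoly, eval_add, eval_finsetSum, eval_mul, eval_C, eval_pow,
    eval_X, eval_one, map_add, map_sum, map_mul, map_pow, map_inv₀, Complex.conj_conj, mul_add,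
    Finset.mul_sum]
  congr 1
  · rw [← mul_pow, mul_inv_cancel₀ hx, one_pow]
  · rw [← Equiv.sum_comp Fin.revPerm]
    refine Finset.sum_congr rfl fun i _ => ?_
    have h : x ^ n = x ^ ((i.rev : ℕ) + 1) * x ^ (i : ℕ) := by
      rw [← pow_add]; congr 1; simp only [Fin.val_rev]; omega
    simp only [Fin.revPerm_apply, Fin.rev_rev]
    rw [h, inv_pow]
    field_simp

theorem monicPoly_eq_of_monic {p : ℂ[X]} (hp : p.Monic) (hd : p.natDegree = n) :
    monicPoly (fun i : Fin n => p.coeff i) = p := by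
  rw [monicPoly, Fin.sum_univ_eq_sum_range (fun i => C (p.coeff i) * X ^ i) n]
  subst hd
  exact hp.as_sum.symm

theorem coeff_monicPoly (c : Fin n → ℂ) (i : Fin n) : (monicPoly c).coeff i = c i := by
  simp only [monicPoly, coeff_add, coeff_X_pow, finsetSum_coeff, coeff_C_mul, i.2.ne, if_false,
    zero_add, Fin.val_inj, mul_ite, mul_one, mul_zero]
  simp

theorem degree_sum_lt (c : Fin n → ℂ) :
    (∑ i : Fin n, C (c i) * (X : ℂ[X]) ^ (i : ℕ)).degree < n := by
  refine (degree_sum_le _ _).trans_lt ((Finset.sup_lt_iff (WithBot.bot_lt_coe n)).2 fun i _ => ?_)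
  exact (degree_C_mul_X_pow_le _ _).trans_lt (Nat.cast_lt.2 i.2)

theorem monic_monicPoly (c : Fin n → ℂ) : (monicPoly c).Monic :=
  monic_X_pow_add (degree_sum_lt c)

theorem natDegree_monicPoly (c : Fin n → ℂ) : (monicPoly c).natDegree = n := by
  refine natDegree_eq_of_degree_eq_some ?_
  rw [monicPoly, degree_add_eq_left_of_degree_lt] <;> rw [degree_X_pow]
  exact degree_sum_lt c

/-- The non-leading coefficients of the monic polynomial with roots `z`. -/
def rootCoeff (z : Fin n → ℂ) : Fin n → ℂ := fun i => (∏ j, (X - C (z j))).coeff i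

theorem monicPoly_rootCoeff (z : Fin n → ℂ) : monicPoly (rootCoeff z) = ∏ j, (X - C (z j)) :=
  monicPoly_eq_of_monic (monic_prod_of_monic _ _ fun _ _ => monic_X_sub_C _) (by simp)

theorem roots_monicPoly_rootCoeff (z : Fin n → ℂ) :
    (monicPoly (rootCoeff z)).roots = Finset.univ.val.map z := by
  rw [monicPoly_rootCoeff]
  exact roots_multiset_prod_X_sub_C (Finset.univ.val.map z) ▸ by
    rw [Multiset.map_map]; rfl

theorem rootCoeff_eq_iff {z : Fin n → ℂ} {c : Fin n → ℂ} :
    rootCoeff z = c ↔ (monicPoly c).roots = Finset.univ.val.map z := by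
  constructor
  · rintro rfl
    exact roots_monicPoly_rootCoeff z
  · intro h
    have h1 : monicPoly c = ∏ j, (X - C (z j)) := by
      rw [(IsAlgClosed.splits (monicPoly c)).eq_prod_roots_of_monic (monic_monicPoly c), h,
        Multiset.map_map]
      rfl
    funext i
    rw [rootCoeff, ← h1, coeff_monicPoly]

theorem exists_rootCoeff_eq (c : Fin n → ℂ) : ∃ z, rootCoeff z = c := by
  have hcard : (monicPoly c).roots.card = n := by
    rw [← (IsAlgClosed.splits (monicPoly c)).natDegree_eq_card_roots, natDegree_monicPoly]
  obtain ⟨l, hl⟩ := Quot.exists_rep (monicPoly c).roots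
  have hl' : (l : Multiset ℂ) = (monicPoly c).roots := hl
  have hlen : l.length = n := by rw [← hcard, ← hl', Multiset.coe_card]
  subst hlen
  refine ⟨l.get, rootCoeff_eq_iff.2 ?_⟩
  rw [← hl', Fin.univ_val_map, List.ofFn_get]

theorem eval_monicPoly_rootCoeff (z : Fin n → ℂ) (x : ℂ) :
    (monicPoly (rootCoeff z)).eval x = ∏ j, (x - z j) := by
  simp [monicPoly_rootCoeff, eval_prod]

theorem eval_reversedPoly_rootCoeff (z : Fin n → ℂ) (x : ℂ) :
    (reversedPoly (rootCoeff z)).eval x = ∏ j, (1 - x * conj (z j)) := by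
  rcases eq_or_ne x 0 with rfl | hx
  · simp [reversedPoly, eval_finsetSum]
  · have hpow : x ^ n = ∏ _j : Fin n, x := by simp
    rw [eval_reversedPoly _ hx, eval_monicPoly_rootCoeff, map_prod, hpow,
      ← Finset.prod_mul_distrib]
    refine Finset.prod_congr rfl fun j _ => ?_
    simp only [map_sub, map_inv₀, Complex.conj_conj, mul_sub, mul_inv_cancel₀ hx]

theorem isDiskStable_rootCoeff {z : Fin n → ℂ} :
    IsDiskStable (rootCoeff z) ↔ ∀ i, ‖z i‖ < 1 := by
  simp only [IsDiskStable, eval_monicPoly_rootCoeff, Finset.prod_ne_zero_iff, sub_ne_zero,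
    Finset.mem_univ, true_imp_iff]
  constructor
  · intro h i
    by_contra! hi
    exact h _ hi i rfl
  · rintro h x hx i rfl
    exact absurd (h i) hx.not_gt

/-- The comparison is made root by root: |x-z|² - |1 - x conj(z)|² = (|x|²-1)(1-|z|²) ≥ 0. -/
theorem IsDiskStable.norm_eval_reversedPoly_le {c : Fin n → ℂ} (hc : IsDiskStable c) {x : ℂ}
    (hx : 1 ≤ ‖x‖) : ‖(reversedPoly c).eval x‖ ≤ ‖(monicPoly c).eval x‖ := by
  obtain ⟨z, rfl⟩ := exists_rootCoeff_eq c
  rw [eval_reversedPoly_rootCoeff, eval_monicPoly_rootCoeff, norm_prod, norm_prod]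
  refine Finset.prod_le_prod (fun _ _ => norm_nonneg _) fun j _ => ?_
  have hz := isDiskStable_rootCoeff.1 hc j
  rw [← sq_le_sq₀ (norm_nonneg _) (norm_nonneg _), Complex.sq_norm, Complex.sq_norm,
    Complex.normSq_apply, Complex.normSq_apply]
  have h1 : 1 ≤ x.re * x.re + x.im * x.im := by
    rw [← Complex.normSq_apply, ← Complex.sq_norm]; nlinarith
  have h2 : (z j).re * (z j).re + (z j).im * (z j).im ≤ 1 := by
    rw [← Complex.normSq_apply, ← Complex.sq_norm]; nlinarith [norm_nonneg (z j)]
  simp only [Complex.sub_re, Complex.sub_im, Complex.one_re, Complex.one_im, Complex.mul_re,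
    Complex.mul_im, Complex.conj_re, Complex.conj_im]
  nlinarith [mul_nonneg (sub_nonneg.2 h1) (sub_nonneg.2 h2)]

/-- If Φ_{n+1} or Φ_n vanished at some |x| ≥ 1, the recursion would bound the modulus of the other
polynomial there by |a| times that of its reversal. Since |a| < 1 and the reversal is dominated,
that polynomial would vanish too. -/
theorem isDiskStable_szegoStep {a : ℂ} (ha : ‖a‖ < 1) {c : Fin n → ℂ} :
    IsDiskStable (szegoStep a c) ↔ IsDiskStable c := by
  constructor
  · intro h x hx h0
    have hle := h.norm_eval_reversedPoly_le hx
    have hne := norm_pos_iff.2 (h x hx)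
    have heq : (monicPoly (szegoStep a c)).eval x =
        -(conj a * (reversedPoly (szegoStep a c)).eval x) := by
      simp [monicPoly_szegoStep, reversedPoly_szegoStep, h0]
    have hn := congrArg norm heq
    rw [norm_neg, norm_mul, RCLike.norm_conj] at hn
    nlinarith [norm_nonneg a]
  · intro h x hx h0
    have hle := h.norm_eval_reversedPoly_le hx
    have hne := norm_pos_iff.2 (h x hx)
    have heq : x * (monicPoly c).eval x = conj a * (reversedPoly c).eval x := by
      simpa [monicPoly_szegoStep, sub_eq_zero] using h0
    have hn := congrArg norm heq
    rw [norm_mul, norm_mul, RCLike.norm_conj] at hn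
    nlinarith [norm_nonneg a]

theorem IsDiskStable.norm_coeff_zero_lt {c : Fin (n + 1) → ℂ} (hc : IsDiskStable c) :
    ‖c 0‖ < 1 := by
  obtain ⟨z, rfl⟩ := exists_rootCoeff_eq c
  have hz := isDiskStable_rootCoeff.1 hc
  have h0 : rootCoeff z 0 = ∏ j, (0 - z j) := by
    rw [← eval_monicPoly_rootCoeff, ← coeff_zero_eq_eval_zero]
    exact (coeff_monicPoly (rootCoeff z) 0).symm
  rw [h0, norm_prod]
  simp only [zero_sub, norm_neg]
  rw [Fin.prod_univ_succ]
  calc ‖z 0‖ * ∏ i : Fin n, ‖z i.succ‖ ≤ ‖z 0‖ * 1 :=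
        mul_le_mul_of_nonneg_left
          (Finset.prod_le_one (fun _ _ => norm_nonneg _) fun i _ => (hz _).le) (norm_nonneg _)
    _ < 1 := by rw [mul_one]; exact hz 0

theorem pairEnergy_map (z : Fin n → ℂ) :
    pairEnergy (Finset.univ.val.map z) = ∏ j, ∏ k, ‖1 - z j * conj (z k)‖ := by
  simp only [pairEnergy, Multiset.map_map, Function.comp_def]
  rfl

/-- With w the roots of Φ_{n+1} and z those of Φ_n, the energies are ∏|Φ_{n+1}^*(w_k)| and
∏|Φ_n^*(z_j)|. Both reduce to the mixed product ∏|1 - w_k conj(z_j)|, which can be read as Φ_n^* at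
the w_k or as Φ_{n+1}^* at the z_j. -/
theorem pairEnergy_szegoStep {a : ℂ} (ha : ‖a‖ ≤ 1) (c : Fin n → ℂ) :
    pairEnergy (monicPoly (szegoStep a c)).roots =
      (1 - ‖a‖ ^ 2) ^ (n + 1) * pairEnergy (monicPoly c).roots := by
  obtain ⟨z, hz⟩ := exists_rootCoeff_eq c
  obtain ⟨w, hw⟩ := exists_rootCoeff_eq (szegoStep a c)
  rw [rootCoeff_eq_iff.1 hz, rootCoeff_eq_iff.1 hw, pairEnergy_map, pairEnergy_map]
  simp only [← norm_prod, ← eval_reversedPoly_rootCoeff, hz, hw]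
  -- At a root of Φ_{n+1} one has XΦ_n = conj(a)Φ_n^*; each of the n+1 roots thus contributes one
  -- factor 1-|a|².
  have hw' : ∀ k, (reversedPoly (szegoStep a c)).eval (w k) =
      ((1 - ‖a‖ ^ 2 : ℝ) : ℂ) * (reversedPoly c).eval (w k) := fun k => by
    have h0 : (monicPoly (szegoStep a c)).eval (w k) = 0 := by
      rw [← hw, eval_monicPoly_rootCoeff]
      exact Finset.prod_eq_zero (Finset.mem_univ k) (sub_self _)
    have h1 : w k * (monicPoly c).eval (w k) = conj a * (reversedPoly c).eval (w k) := by
      simpa [monicPoly_szegoStep, sub_eq_zero] using h0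
    have h2 : a * conj a = ((‖a‖ ^ 2 : ℝ) : ℂ) := by
      rw [Complex.mul_conj, Complex.normSq_eq_norm_sq]
    rw [reversedPoly_szegoStep, eval_sub, eval_mul, eval_mul, eval_C, eval_X, h1, ← mul_assoc, h2]
    push_cast
    ring
  have hz' : ∀ j, (reversedPoly (szegoStep a c)).eval (z j) = (reversedPoly c).eval (z j) :=
    fun j => by
    have h0 : (monicPoly c).eval (z j) = 0 := by
      rw [← hz, eval_monicPoly_rootCoeff]
      exact Finset.prod_eq_zero (Finset.mem_univ j) (sub_self _)
    simp [reversedPoly_szegoStep, h0]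
  have hcomm : ∏ k, ‖(reversedPoly c).eval (w k)‖ = ∏ j, ‖(reversedPoly c).eval (z j)‖ := by
    simp only [← hz', ← hw]
    rw [← hz]
    simp only [eval_reversedPoly_rootCoeff, norm_prod]
    rw [Finset.prod_comm]
    refine Finset.prod_congr rfl fun j _ => Finset.prod_congr rfl fun k _ => ?_
    rw [← RCLike.norm_conj]
    simp [mul_comm]
  simp only [hw', norm_prod, norm_mul, Finset.prod_mul_distrib, Finset.prod_const,
    Finset.card_univ, Fintype.card_fin, hcomm]
  rw [norm_pow, Complex.norm_real]
  congr 2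
  rw [Real.norm_eq_abs, abs_of_nonneg]
  nlinarith [norm_nonneg a]

end CutoffCMV

end

/-! ### The characteristic polynomial of the CMV matrix. -/

noncomputable section

namespace CutoffCMV

open Polynomial Matrix

/-- The determinant of `X - A * B` with last row replaced by the last row of `B`. -/
def bordered {m : ℕ} (A B : Matrix (Fin (m + 1)) (Fin (m + 1)) ℂ) : ℂ[X] :=
  ((charmatrix (A * B)).updateRow (Fin.last m) fun j => C (B (Fin.last m) j)).det

/-- The upper left corner, without the last row and column. -/
def corner {m : ℕ} (A : Matrix (Fin (m + 1)) (Fin (m + 1)) ℂ) : Matrix (Fin m) (Fin m) ℂ :=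
  A.submatrix Fin.castSucc Fin.castSucc

variable {m : ℕ}

theorem corner_mul {A : Matrix (Fin (m + 1)) (Fin (m + 1)) ℂ}
    (hA : ∀ i : Fin m, A i.castSucc (Fin.last m) = 0) (B : Matrix (Fin (m + 1)) (Fin (m + 1)) ℂ) :
    corner (A * B) = corner A * corner B := by
  ext i j
  simp [corner, Matrix.mul_apply, Fin.sum_univ_castSucc, hA]

theorem charmatrix_corner (A : Matrix (Fin (m + 1)) (Fin (m + 1)) ℂ) :
    (charmatrix A).submatrix Fin.castSucc Fin.castSucc = charmatrix (corner A) := by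
  ext i j
  simp [charmatrix_apply, corner, Matrix.diagonal_apply]

theorem det_updateRow_last_single (N : Matrix (Fin (m + 1)) (Fin (m + 1)) ℂ[X]) :
    (N.updateRow (Fin.last m) (Pi.single (Fin.last m) 1)).det =
      (N.submatrix Fin.castSucc Fin.castSucc).det := by
  rw [← Matrix.adjugate_apply, Matrix.adjugate_fin_succ_eq_det_submatrix]
  simp [Fin.succAbove_last]

/-- Expansion of the characteristic polynomial along a last row that is a multiple of the last
row of `B`. -/
theorem charpoly_mul_of_last_row {A B : Matrix (Fin (m + 1)) (Fin (m + 1)) ℂ} {x : ℂ}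
    (hcol : ∀ i : Fin m, A i.castSucc (Fin.last m) = 0)
    (hrow : ∀ i : Fin m, A (Fin.last m) i.castSucc = 0)
    (hx : A (Fin.last m) (Fin.last m) = x) :
    (A * B).charpoly = X * (corner A * corner B).charpoly - C x * bordered A B := by
  -- The last row of `A` is x times a unit vector, so the last row of X - AB is X e_last - x · (last
  -- row of `B`); the determinant is linear in that row.
  have hN : charmatrix (A * B) = (charmatrix (A * B)).updateRow (Fin.last m)
      ((X : ℂ[X]) • Pi.single (Fin.last m) 1 + (-C x) • fun j => C (B (Fin.last m) j)) := by
    ext1 i j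
    refine Fin.lastCases ?_ (fun i => ?_) i
    swap
    · rw [Matrix.updateRow_ne (Fin.castSucc_lt_last i).ne]
    have h : (A * B) (Fin.last m) j = x * B (Fin.last m) j := by
      simp [Matrix.mul_apply, Fin.sum_univ_castSucc, hrow, hx]
    simp [charmatrix_apply, h, Matrix.diagonal_apply, Pi.single_apply, sub_eq_add_neg, eq_comm]
  rw [Matrix.charpoly, hN, Matrix.det_updateRow_add, Matrix.det_updateRow_smul,
    Matrix.det_updateRow_smul, det_updateRow_last_single, charmatrix_corner, corner_mul hcol,
    bordered, Matrix.charpoly]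
  ring

/-- The bordered determinant when the last row of `B` closes a symmetric block
`(·, r; r, -a)`. -/
theorem bordered_eq {A B : Matrix (Fin (m + 2)) (Fin (m + 2)) ℂ} {a r : ℂ}
    (hcol : ∀ i : Fin (m + 1), A i.castSucc (Fin.last _) = 0)
    (hBrow : ∀ i : Fin m, B (Fin.last _) i.castSucc.castSucc = 0)
    (hBcol : ∀ i : Fin m, B i.castSucc.castSucc (Fin.last _) = 0)
    (hr : B (Fin.last _) (Fin.last m).castSucc = r)
    (hr' : B (Fin.last m).castSucc (Fin.last _) = r)
    (ha : B (Fin.last _) (Fin.last _) = -a) :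
    bordered A B = -(C a) * (corner A * corner B).charpoly +
      C (r ^ 2) * bordered (corner B)ᵀ (corner A)ᵀ := by
  have hlast : (fun j => C (B (Fin.last (m + 1)) j)) =
      (-(C a)) • Pi.single (Fin.last (m + 1)) 1 + (C r) • Pi.single (Fin.last m).castSucc 1 := by
    ext1 j
    refine Fin.lastCases ?_ (fun j => ?_) j
    · simp [ha, Fin.ext_iff]
    · refine Fin.lastCases ?_ (fun j => ?_) j
      · simp [hr, Fin.ext_iff]
      · have := j.2
        simp [hBrow, Fin.ext_iff, this.ne, (this.trans (Nat.lt_succ_self _)).ne]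
  rw [bordered, hlast, Matrix.det_updateRow_add, Matrix.det_updateRow_smul,
    Matrix.det_updateRow_smul, det_updateRow_last_single, charmatrix_corner, corner_mul hcol,
    ← Matrix.adjugate_apply, Matrix.adjugate_fin_succ_eq_det_submatrix]
  -- The cofactor at the entry r is again bordered, but along a column: the surviving last column is
  -- -r times a column of `corner A`. Transposition turns it into a bordered determinant with the
  -- factors exchanged.
  have hsub : (charmatrix (A * B)).submatrix (Fin.last (m + 1)).succAbove
      (Fin.last m).castSucc.succAbove =
      (charmatrix (corner A * corner B)).updateCol (Fin.last m)
        ((-C r) • fun i => C (corner A i (Fin.last m))) := by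
    ext1 i j
    rw [Fin.succAbove_last, ← corner_mul hcol, ← charmatrix_corner]
    refine Fin.lastCases ?_ (fun j => ?_) j
    · have h : (A * B) i.castSucc (Fin.last (m + 1)) =
          A i.castSucc (Fin.last m).castSucc * r := by
        simp [Matrix.mul_apply, Fin.sum_univ_castSucc, hcol, hBcol, hr']
      simp [h, corner, mul_comm, Fin.ext_iff, i.2.ne]
    · have h : (Fin.last m).castSucc.succAbove j.castSucc = j.castSucc.castSucc := by
        rw [Fin.succAbove_of_castSucc_lt]
        simp [Fin.lt_def]
      have hne : j.castSucc ≠ Fin.last m := (Fin.castSucc_lt_last j).ne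
      simp [h, hne]
  have hb : bordered (corner B)ᵀ (corner A)ᵀ = ((charmatrix (corner A * corner B)).updateCol
      (Fin.last m) fun i => C (corner A i (Fin.last m))).det := by
    rw [bordered, ← Matrix.transpose_mul, Matrix.charmatrix_transpose, Matrix.updateRow_transpose,
      Matrix.det_transpose]
    rfl
  rw [hsub, Matrix.det_updateCol_smul, hb, Matrix.charpoly]
  have hsign : (-1 : ℂ[X]) ^ (((Fin.last (m + 1) : Fin (m + 2)) : ℕ) +
      (((Fin.last m).castSucc : Fin (m + 2)) : ℕ)) = -1 := by
    simp only [Fin.val_last, Fin.val_castSucc]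
    exact Odd.neg_one_pow ⟨m, by ring⟩
  rw [hsign]
  simp only [map_pow]
  ring

/-- The symmetric block diagonal matrix with blocks `Ξ_k`, `k ≡ p mod 2`, in rows and columns
`k, k + 1`. -/
def blockFactor (p : ℕ) {n : ℕ} (α : Fin n → ℂ) : Matrix (Fin n) (Fin n) ℂ :=
  Matrix.of fun i j =>
    if (i : ℕ) = j then
      if (i : ℕ) % 2 = p % 2 then conj (α i)
      else if (i : ℕ) = 0 then 1 else -α ⟨i - 1, by omega⟩
    else if (j : ℕ) = i + 1 ∧ (i : ℕ) % 2 = p % 2 then (Real.sqrt (1 - ‖α i‖ ^ 2) : ℂ)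
    else if (i : ℕ) = j + 1 ∧ (j : ℕ) % 2 = p % 2 then (Real.sqrt (1 - ‖α j‖ ^ 2) : ℂ)
    else 0

theorem cmvL_eq_blockFactor {n : ℕ} (α : Fin n → ℂ) : cmvL α = blockFactor 0 α := by
  ext ⟨i, hi⟩ ⟨j, hj⟩
  obtain ⟨q, rfl | rfl⟩ : ∃ q, i = 2 * q ∨ i = 2 * q + 1 := ⟨i / 2, by omega⟩ <;>
  obtain ⟨r, rfl | rfl⟩ : ∃ r, j = 2 * r ∨ j = 2 * r + 1 := ⟨j / 2, by omega⟩ <;>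
  rcases eq_or_ne q r with rfl | hqr
  all_goals simp [cmvL, blockFactor, xi, Nat.mul_add_div, Nat.add_mod]
  all_goals split_ifs <;> first | rfl | omega

theorem cmvM_eq_blockFactor {n : ℕ} (α : Fin n → ℂ) : cmvM α = blockFactor 1 α := by
  have h1 : ∀ q, (2 * q + 1 + 1) / 2 = q + 1 := by omega
  have h2 : ∀ q, (2 * q + 2 + 1) / 2 = q + 1 := by omega
  have h3 : ∀ q, 2 * (q + 1) - 1 = 2 * q + 1 := by omega
  ext ⟨i, hi⟩ ⟨j, hj⟩
  obtain rfl | ⟨q, rfl | rfl⟩ : i = 0 ∨ ∃ q, i = 2 * q + 1 ∨ i = 2 * q + 2 := by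
    rcases i with _ | i
    · exact Or.inl rfl
    · exact Or.inr ⟨i / 2, by omega⟩
  all_goals
    obtain rfl | ⟨r, rfl | rfl⟩ : j = 0 ∨ ∃ r, j = 2 * r + 1 ∨ j = 2 * r + 2 := by
      rcases j with _ | j
      · exact Or.inl rfl
      · exact Or.inr ⟨j / 2, by omega⟩
  all_goals simp [cmvM, blockFactor, xi, Nat.add_mod, h1, h2, h3]
  all_goals
    try rcases eq_or_ne q r with rfl | hqr
    all_goals first | omega | simp | (split_ifs <;> first | rfl | omega)

theorem blockFactor_congr {p q : ℕ} (h : p % 2 = q % 2) {n : ℕ} (α : Fin n → ℂ) :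
    blockFactor p α = blockFactor q α := by
  simp only [blockFactor, h]

theorem blockFactor_transpose (p : ℕ) {n : ℕ} (α : Fin n → ℂ) :
    (blockFactor p α)ᵀ = blockFactor p α := by
  ext i j
  rcases eq_or_ne i j with rfl | h
  · rfl
  have h' : (i : ℕ) ≠ j := fun e => h (Fin.ext e)
  simp only [blockFactor, Matrix.transpose_apply, Matrix.of_apply, h', h'.symm, if_false]
  split_ifs <;> first | rfl | omega

theorem corner_blockFactor (p : ℕ) {n : ℕ} (α : Fin (n + 1) → ℂ) :
    corner (blockFactor p α) = blockFactor p (Fin.init α) := rfl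

/-- In the factor whose parity is that of the last index, the block starting there is cut to its
corner entry, so the last row and column decouple. -/
theorem charpoly_blockFactor_succ {n : ℕ} (α : Fin (n + 1) → ℂ) :
    (blockFactor n α * blockFactor (n + 1) α).charpoly =
      X * (blockFactor n (Fin.init α) * blockFactor (n + 1) (Fin.init α)).charpoly -
        C (conj (α (Fin.last n))) * bordered (blockFactor n α) (blockFactor (n + 1) α) := by
  refine charpoly_mul_of_last_row (fun i => ?_) (fun i => ?_) ?_
  · have := i.2
    simp only [blockFactor, Matrix.of_apply, Fin.val_castSucc, Fin.val_last]
    split_ifs <;> first | rfl | omega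
  · have := i.2
    simp only [blockFactor, Matrix.of_apply, Fin.val_castSucc, Fin.val_last]
    split_ifs <;> first | rfl | omega
  · simp [blockFactor]

theorem bordered_blockFactor_succ {n : ℕ} (α : Fin (n + 2) → ℂ) (hα : ∀ k, ‖α k‖ ≤ 1) :
    bordered (blockFactor (n + 1) α) (blockFactor n α) =
      -(C (Fin.init α (Fin.last n))) *
        (blockFactor (n + 1) (Fin.init α) * blockFactor n (Fin.init α)).charpoly +
      C (1 - Fin.init α (Fin.last n) * conj (Fin.init α (Fin.last n))) *
        bordered (blockFactor n (Fin.init α)) (blockFactor (n + 1) (Fin.init α)) := by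
  have hsq : (1 - Fin.init α (Fin.last n) * conj (Fin.init α (Fin.last n))) =
      (Real.sqrt (1 - ‖Fin.init α (Fin.last n)‖ ^ 2) : ℂ) ^ 2 := by
    have h1 : 0 ≤ 1 - ‖Fin.init α (Fin.last n)‖ ^ 2 := by
      have := hα (Fin.last n).castSucc
      simp only [Fin.init]
      nlinarith [norm_nonneg (α (Fin.last n).castSucc)]
    rw [← Complex.ofReal_pow, Real.sq_sqrt h1, Complex.mul_conj, Complex.normSq_eq_norm_sq]
    push_cast
    ring
  rw [hsq]
  have h := bordered_eq (A := blockFactor (n + 1) α) (B := blockFactor n α)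
    (a := Fin.init α (Fin.last n)) (r := (Real.sqrt (1 - ‖Fin.init α (Fin.last n)‖ ^ 2) : ℂ))
    (fun i => ?_) (fun i => ?_) (fun i => ?_) ?_ ?_ ?_
  · simpa only [corner_blockFactor, blockFactor_transpose] using h
  · have := i.2
    simp only [blockFactor, Matrix.of_apply, Fin.val_castSucc, Fin.val_last]
    split_ifs <;> first | rfl | omega
  · have := i.2
    simp only [blockFactor, Matrix.of_apply, Fin.val_castSucc, Fin.val_last]
    split_ifs <;> first | rfl | omega
  · have := i.2
    simp only [blockFactor, Matrix.of_apply, Fin.val_castSucc, Fin.val_last]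
    split_ifs <;> first | rfl | omega
  · simp [blockFactor, Fin.init]
    omega
  · simp [blockFactor, Fin.init]
  · have h2 : ¬ (n + 1) % 2 = n % 2 := by omega
    simp [blockFactor, h2, Fin.init]
    rfl

/-- Neither identity closes an induction alone: together they carry the pair (Φ, Φ^*) through the
Szegő recursion. The parities of the two factors alternate with the size, which is harmless because
`AB` and `BA` have the same characteristic polynomial. -/
theorem bordered_blockFactor : ∀ {n : ℕ} (α : Fin (n + 1) → ℂ), (∀ k, ‖α k‖ ≤ 1) →
    (blockFactor n (Fin.init α) * blockFactor (n + 1) (Fin.init α)).charpoly =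
        monicPoly (szegoCoeff (Fin.init α)) ∧
      bordered (blockFactor n α) (blockFactor (n + 1) α) =
        reversedPoly (szegoCoeff (Fin.init α))
  | 0, α, _ => by
    constructor
    · simp [Matrix.charpoly, monicPoly]
    · simp [bordered, reversedPoly, blockFactor]
  | n + 1, α, hα => by
    obtain ⟨h1, h2⟩ := bordered_blockFactor (Fin.init α) fun k => hα k.castSucc
    have h3 := charpoly_blockFactor_succ (Fin.init α)
    rw [h1, h2, ← monicPoly_szegoStep] at h3
    have h3' : (blockFactor (n + 1) (Fin.init α) * blockFactor n (Fin.init α)).charpoly =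
        monicPoly (szegoCoeff (Fin.init α)) := by
      rw [Matrix.charpoly_mul_comm]; exact h3
    have hp : ∀ {k : ℕ} (γ : Fin k → ℂ), blockFactor (n + 1 + 1) γ = blockFactor n γ :=
      blockFactor_congr (by omega)
    simp only [hp]
    refine ⟨h3', ?_⟩
    -- What remains is -a(XΦ - conj(a)Φ^*) + (1 - a conj(a))Φ^* = Φ^* - aXΦ.
    rw [bordered_blockFactor_succ α hα, h3', h2]
    simp only [szegoCoeff, monicPoly_szegoStep, reversedPoly_szegoStep, map_sub, map_mul, map_one]
    ring

/-- The characteristic polynomial of the CMV matrix is the monic orthogonal polynomial. -/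
theorem charpoly_cmv {n : ℕ} (α : Fin n → ℂ) (hα : ∀ k, ‖α k‖ ≤ 1) :
    (cmv α).charpoly = monicPoly (szegoCoeff α) := by
  -- The appended 0 is a dummy: the identity used involves only the initial segment.
  have h := (bordered_blockFactor (Fin.snoc α 0 : Fin (n + 1) → ℂ) fun k => by
    refine Fin.lastCases ?_ (fun k => ?_) k <;> simp [hα]).1
  rw [Fin.init_snoc] at h
  rw [← h, cmv, cmvL_eq_blockFactor, cmvM_eq_blockFactor]
  rcases Nat.even_or_odd n with hn | hn
  · rw [blockFactor_congr (p := n) (q := 0), blockFactor_congr (p := n + 1) (q := 1)] <;> grind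
  · rw [Matrix.charpoly_mul_comm, blockFactor_congr (p := n) (q := 1),
      blockFactor_congr (p := n + 1) (q := 0)] <;> grind

end CutoffCMV

end

/-! ### Change of variables between coefficients and roots. -/

noncomputable section

namespace CutoffCMV

open Polynomial Matrix

variable {n : ℕ}

/-- The lexicographic order on `ℂ`. -/
def lexKey (z : ℂ) : ℝ ×ₗ ℝ := toLex (z.re, z.im)

theorem lexKey_injective : Function.Injective lexKey := fun z w h => by
  have h' : (z.re, z.im) = (w.re, w.im) := toLex.injective h
  exact Complex.ext (congrArg Prod.fst h') (congrArg Prod.snd h')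

/-- The tuples sorted lexicographically. -/
def sortedTuples (n : ℕ) : Set (Fin n → ℂ) := {z | Monotone (lexKey ∘ z)}

theorem measurableSet_sortedTuples : MeasurableSet (sortedTuples n) := by
  have h : sortedTuples n = ⋂ (i : Fin n) (j : Fin n) (_ : i ≤ j),
      {z | (z i).re < (z j).re ∨ ((z i).re = (z j).re ∧ (z i).im ≤ (z j).im)} := by
    ext z
    simp only [sortedTuples, Monotone, Function.comp, lexKey, Prod.Lex.toLex_le_toLex,
      Set.mem_iInter, Set.mem_ofPred_eq]
  rw [h]
  refine MeasurableSet.iInter fun i => MeasurableSet.iInter fun j =>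
    MeasurableSet.iInter fun _ => ?_
  have hre : ∀ i, Measurable fun z : Fin n → ℂ => (z i).re := fun i =>
    Complex.measurable_re.comp (measurable_pi_apply i)
  have him : ∀ i, Measurable fun z : Fin n → ℂ => (z i).im := fun i =>
    Complex.measurable_im.comp (measurable_pi_apply i)
  exact (measurableSet_lt (hre i) (hre j)).union
    ((measurableSet_eq_fun (hre i) (hre j)).inter (measurableSet_le (him i) (him j)))

theorem rootCoeff_comp_perm (z : Fin n → ℂ) (σ : Equiv.Perm (Fin n)) :
    rootCoeff (z ∘ σ) = rootCoeff z := by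
  funext i
  simp only [rootCoeff, Function.comp]
  rw [Equiv.prod_comp σ fun j => X - C (z j)]

theorem injOn_rootCoeff : Set.InjOn rootCoeff (sortedTuples n) := by
  intro z hz w hw h
  have h1 := congrArg (Multiset.map lexKey) (rootCoeff_eq_iff.1 h)
  rw [roots_monicPoly_rootCoeff, Multiset.map_map, Multiset.map_map, Fin.univ_val_map,
    Fin.univ_val_map, Multiset.coe_eq_coe] at h1
  have h2 := List.ofFn_injective (h1.eq_of_sortedLE (List.sortedLE_ofFn_iff.2 hw)
    (List.sortedLE_ofFn_iff.2 hz))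
  funext i
  exact lexKey_injective (congrFun h2 i).symm

theorem differentiable_rootCoeff : Differentiable ℂ (rootCoeff : (Fin n → ℂ) → Fin n → ℂ) := by
  have key : ∀ s : Finset (Fin n), ∀ i : ℕ,
      Differentiable ℂ fun z : Fin n → ℂ => (∏ j ∈ s, (X - C (z j))).coeff i := by
    intro s
    induction s using Finset.induction_on with
    | empty => intro i; simp
    | insert a s ha ih =>
      intro i
      simp only [Finset.prod_insert ha, sub_mul, coeff_sub, coeff_C_mul]
      rcases i with _ | i
      · simp only [mul_coeff_zero, coeff_X_zero, zero_mul]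
        exact (differentiable_const _).sub (by have := ih 0; fun_prop)
      · simp only [coeff_X_mul]
        have h1 := ih i
        have h2 := ih (i + 1)
        fun_prop
  exact differentiable_pi.2 fun i => key _ i

theorem continuous_rootCoeff : Continuous (rootCoeff : (Fin n → ℂ) → Fin n → ℂ) :=
  differentiable_rootCoeff.continuous

/-- A Borel symmetric function of the roots is a Borel function of the coefficients. -/
theorem measurable_roots {F : Multiset ℂ → ℝ≥0∞}
    (hF : Measurable fun z : Fin n → ℂ => F (Finset.univ.val.map z)) :
    Measurable fun c : Fin n → ℂ => F (monicPoly c).roots := by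
  intro B hB
  have h : (fun c : Fin n → ℂ => F (monicPoly c).roots) ⁻¹' B =
      rootCoeff '' (sortedTuples n ∩ (fun z : Fin n → ℂ => F (Finset.univ.val.map z)) ⁻¹' B) := by
    ext c
    constructor
    · intro hc
      obtain ⟨z, rfl⟩ := exists_rootCoeff_eq c
      refine ⟨z ∘ Tuple.sort (lexKey ∘ z), ⟨Tuple.monotone_sort (lexKey ∘ z), ?_⟩,
        rootCoeff_comp_perm _ _⟩
      rw [Set.mem_preimage, ← roots_monicPoly_rootCoeff, rootCoeff_comp_perm]
      exact hc
    · rintro ⟨z, ⟨_, hz⟩, rfl⟩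
      rw [Set.mem_preimage, roots_monicPoly_rootCoeff]
      exact hz
  rw [h]
  -- Lusin–Souslin: an injective Borel image of a Borel set is Borel. This replaces any measurable
  -- choice of roots.
  exact (measurableSet_sortedTuples.inter (hF hB)).image_of_measurable_injOn
    continuous_rootCoeff.measurable (injOn_rootCoeff.mono Set.inter_subset_left)

/-- The squared modulus of the Vandermonde determinant. -/
def vandermondeSq (z : Fin n → ℂ) : ℝ := ∏ i, ∏ j ∈ Finset.Ioi i, ‖z j - z i‖ ^ 2

theorem vandermondeSq_eq (z : Fin n → ℂ) : vandermondeSq z = ‖(vandermonde z).det‖ ^ 2 := by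
  simp only [vandermondeSq, det_vandermonde, norm_prod, Finset.prod_pow]

theorem vandermondeSq_comp_perm (z : Fin n → ℂ) (σ : Equiv.Perm (Fin n)) :
    vandermondeSq (z ∘ σ) = vandermondeSq z := by
  have h : vandermonde (z ∘ σ) = (vandermonde z).submatrix σ id := rfl
  rw [vandermondeSq_eq, vandermondeSq_eq, h, Matrix.det_permute, norm_mul]
  rcases Int.units_eq_one_or (Equiv.Perm.sign σ) with h | h <;> simp [h]

theorem continuous_vandermondeSq : Continuous (vandermondeSq : (Fin n → ℂ) → ℝ) := by
  unfold vandermondeSq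
  fun_prop

/-- Evaluating the polynomial with roots y at the fixed points z_m composes `rootCoeff` with the
Vandermonde matrix V of z. At y = z this composite has diagonal derivative with entries -∏_{j≠m}(z_m
- z_j), whose product has modulus |det V|². Hence the complex Jacobian has modulus |det V|, and the
real one is its square. -/
theorem abs_det_fderiv_rootCoeff {z : Fin n → ℂ} (hz : Function.Injective z) :
    |((fderiv ℂ rootCoeff z).restrictScalars ℝ).det| = vandermondeSq z := by
  have hV : (vandermonde z).det ≠ 0 := det_vandermonde_ne_zero_iff.2 hz
  set T : (Fin n → ℂ) →L[ℂ] (Fin n → ℂ) := LinearMap.toContinuousLinearMap (toLin' (vandermonde z))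
    with hT
  set D := fderiv ℂ rootCoeff z with hD
  have hTe : ∀ y m, T (rootCoeff y) m = (∏ j, (z m - y j)) - z m ^ n := by
    intro y m
    rw [← eval_monicPoly_rootCoeff, monicPoly, eval_add, eval_pow, eval_X, add_sub_cancel_left,
      eval_finsetSum]
    change ∑ i, vandermonde z m i * rootCoeff y i = _
    refine Finset.sum_congr rfl fun i _ => ?_
    rw [eval_mul, eval_C, eval_pow, eval_X, vandermonde_apply, mul_comm]
  have h1 : HasFDerivAt (fun y => T (rootCoeff y)) (T ∘L D) z :=
    T.hasFDerivAt.comp z (differentiable_rootCoeff z).hasFDerivAt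
  have h2 : ∀ m, HasFDerivAt (fun y => T (rootCoeff y) m)
      ((∏ j ∈ Finset.univ.erase m, (z m - z j)) •
        -(ContinuousLinearMap.proj m : (Fin n → ℂ) →L[ℂ] ℂ)) z := by
    intro m
    simp only [hTe]
    refine HasFDerivAt.sub_const _ ?_
    have h3 := HasFDerivAt.finsetProd (u := Finset.univ) (x := z)
      (g := fun (j : Fin n) (y : Fin n → ℂ) => z m - y j)
      (g' := fun j => -(ContinuousLinearMap.proj j : (Fin n → ℂ) →L[ℂ] ℂ))
      fun j _ => (ContinuousLinearMap.proj (R := ℂ) (φ := fun _ : Fin n => ℂ)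
        j).hasFDerivAt.const_sub _
    -- In the product rule every term with j ≠ m retains the factor z_m - z_m.
    rw [Finset.sum_eq_single m] at h3
    · exact h3
    · intro j _ hj
      rw [Finset.prod_eq_zero (Finset.mem_erase.2 ⟨hj.symm, Finset.mem_univ m⟩) (sub_self _)]
      ext v
      simp
    · simp
  have h4 : (T ∘L D : (Fin n → ℂ) →ₗ[ℂ] (Fin n → ℂ)) =
      toLin' (diagonal fun m => -∏ j ∈ Finset.univ.erase m, (z m - z j)) := by
    refine LinearMap.ext fun v => funext fun m => ?_
    have h5 := ((hasFDerivAt_pi'.1 h1) m).unique (h2 m)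
    have h6 := congrArg (fun f => f v) h5
    simp only [ContinuousLinearMap.comp_apply, ContinuousLinearMap.proj_apply] at h6
    simp only [ContinuousLinearMap.coe_coe, toLin'_apply, mulVec_diagonal]
    rw [ContinuousLinearMap.comp_apply, h6]
    simp
  have h5 := congrArg LinearMap.det h4
  rw [ContinuousLinearMap.toLinearMap_comp, LinearMap.det_comp, LinearMap.det_toLin',
    det_diagonal] at h5
  have hTdet : LinearMap.det (T : (Fin n → ℂ) →ₗ[ℂ] (Fin n → ℂ)) = (vandermonde z).det := by
    rw [hT, LinearMap.coe_toContinuousLinearMap, LinearMap.det_toLin']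
  rw [hTdet] at h5
  have h6 := congrArg norm h5
  have h7 : ∏ i, ∏ j ∈ Finset.univ.erase i, ‖z i - z j‖ = ‖(vandermonde z).det‖ ^ 2 := by
    have := Finset.prod_prod_Ioi_mul_eq_prod_prod_off_diag fun i j : Fin n => ‖z j - z i‖
    simp only [← Finset.compl_singleton]
    rw [← this, ← vandermondeSq_eq, vandermondeSq]
    refine Finset.prod_congr rfl fun i _ => Finset.prod_congr rfl fun j _ => ?_
    rw [norm_sub_rev (z i), sq]
  simp only [norm_mul, norm_prod, norm_neg] at h6
  rw [h7, sq] at h6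
  have h8 := mul_left_cancel₀ (norm_ne_zero_iff.2 hV) h6
  have h9 : ((fderiv ℂ rootCoeff z).restrictScalars ℝ).det =
      LinearMap.det (((D : (Fin n → ℂ) →ₗ[ℂ] (Fin n → ℂ))).restrictScalars ℝ) := rfl
  rw [h9, LinearMap.det_restrictScalars, Algebra.norm_complex_apply, Complex.normSq_eq_norm_sq, h8,
    vandermondeSq_eq, abs_of_nonneg (by positivity)]

theorem measurePreserving_comp_perm (σ : Equiv.Perm (Fin n)) :
    MeasurePreserving (fun z : Fin n → ℂ => z ∘ σ) := by
  convert! volume_measurePreserving_piCongrLeft (fun _ : Fin n => ℂ) σ.symm using 1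
  funext z i
  rw [MeasurableEquiv.coe_piCongrLeft, Equiv.piCongrLeft_apply_eq_cast]
  rfl

theorem volume_not_injective : volume {z : Fin n → ℂ | ¬ Function.Injective z} = 0 := by
  have h : {z : Fin n → ℂ | ¬ Function.Injective z} ⊆
      ⋃ (i : Fin n) (j : Fin n) (_ : i ≠ j), {z | z i = z j} := by
    intro z hz
    simp only [Function.Injective, Set.mem_ofPred_eq] at hz
    push Not at hz
    obtain ⟨i, j, h1, h2⟩ := hz
    simp only [Set.mem_iUnion]
    exact ⟨i, j, h2, h1⟩
  refine measure_mono_null h ?_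
  simp only [measure_iUnion_null_iff]
  intro i j hij
  let p : Submodule ℝ (Fin n → ℂ) :=
    LinearMap.eqLocus (LinearMap.proj i : (Fin n → ℂ) →ₗ[ℝ] ℂ) (LinearMap.proj j)
  refine Measure.addHaar_submodule volume p fun hp => ?_
  have h1 : (Pi.single i 1 : Fin n → ℂ) ∈ p := hp ▸ Submodule.mem_top
  have h2 : (Pi.single i 1 : Fin n → ℂ) i = (Pi.single i 1 : Fin n → ℂ) j := h1
  simp [hij.symm] at h2

/-- The strictly sorted tuples. -/
def strictTuples (n : ℕ) : Set (Fin n → ℂ) := sortedTuples n ∩ {z | Function.Injective z}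

theorem measurableSet_injective : MeasurableSet {z : Fin n → ℂ | Function.Injective z} := by
  have h : {z : Fin n → ℂ | Function.Injective z} = ⋂ (i : Fin n) (j : Fin n) (_ : i ≠ j),
      {z | z i = z j}ᶜ := by
    ext z
    simp only [Function.Injective, Set.mem_iInter, Set.mem_ofPred_eq, Set.mem_compl_iff]
    exact forall₂_congr fun i j => by tauto
  rw [h]
  refine MeasurableSet.iInter fun i => MeasurableSet.iInter fun j =>
    MeasurableSet.iInter fun _ => ?_
  exact (measurableSet_eq_fun (by fun_prop) (by fun_prop)).compl

theorem measurableSet_strictTuples : MeasurableSet (strictTuples n) :=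
  measurableSet_sortedTuples.inter measurableSet_injective

theorem comp_mem_strictTuples_iff {z : Fin n → ℂ} (hz : Function.Injective z)
    (σ : Equiv.Perm (Fin n)) : z ∘ σ ∈ strictTuples n ↔ σ = Tuple.sort (lexKey ∘ z) := by
  constructor
  · rintro ⟨h, _⟩
    have h1 := Tuple.unique_monotone (f := lexKey ∘ z) (σ := σ) h (Tuple.monotone_sort (lexKey ∘ z))
    ext i
    exact congrArg Fin.val (hz (lexKey_injective (congrFun h1 i)))
  · rintro rfl
    exact ⟨Tuple.monotone_sort (lexKey ∘ z), hz.comp (Equiv.injective _)⟩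

/-- Strictly sorted tuples form a fundamental domain for the permutation action up to a null set:
exactly one permutation sorts a tuple with distinct entries. -/
theorem lintegral_symmetric {H : (Fin n → ℂ) → ℝ≥0∞} (hH : Measurable H)
    (hsymm : ∀ z (σ : Equiv.Perm (Fin n)), H (z ∘ σ) = H z) :
    ∫⁻ z, H z = n.factorial * ∫⁻ z in strictTuples n, H z := by
  have h1 : ∀ᵐ z : Fin n → ℂ, H z =
      ∑ σ : Equiv.Perm (Fin n), (strictTuples n).indicator H (z ∘ σ) := by
    have h0 : ∀ᵐ z : Fin n → ℂ, Function.Injective z := volume_not_injective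
    filter_upwards [h0] with z hz
    rw [Finset.sum_eq_single (Tuple.sort (lexKey ∘ z))]
    · rw [Set.indicator_of_mem ((comp_mem_strictTuples_iff hz _).2 rfl), hsymm]
    · intro σ _ hσ
      exact Set.indicator_of_notMem (fun h => hσ ((comp_mem_strictTuples_iff hz _).1 h)) _
    · simp
  have hm : Measurable ((strictTuples n).indicator H) := hH.indicator measurableSet_strictTuples
  rw [lintegral_congr_ae h1, lintegral_finsetSum]
  · have h2 : ∀ σ : Equiv.Perm (Fin n), ∫⁻ z, (strictTuples n).indicator H (z ∘ σ) =
        ∫⁻ z in strictTuples n, H z := fun σ => by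
      rw [(measurePreserving_comp_perm σ).lintegral_comp hm,
        lintegral_indicator measurableSet_strictTuples]
    simp [h2, Fintype.card_perm]
  · exact fun σ _ => hm.comp (measurePreserving_comp_perm σ).measurable

theorem map_univ_comp_perm (z : Fin n → ℂ) (σ : Equiv.Perm (Fin n)) :
    Finset.univ.val.map (z ∘ σ) = Finset.univ.val.map z := by
  rw [← roots_monicPoly_rootCoeff, rootCoeff_comp_perm, roots_monicPoly_rootCoeff]

/-- The polynomials missed have a repeated root, and a differentiable map sends the null set of
non-injective tuples to a null set. -/
theorem volume_compl_image_strictTuples :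
    volume (rootCoeff '' strictTuples n)ᶜ = 0 := by
  have h : (rootCoeff '' strictTuples n)ᶜ ⊆
      rootCoeff '' {z : Fin n → ℂ | ¬ Function.Injective z} := by
    intro c hc
    obtain ⟨z, rfl⟩ := exists_rootCoeff_eq c
    refine ⟨z, fun hz => hc ?_, rfl⟩
    exact ⟨z ∘ Tuple.sort (lexKey ∘ z), (comp_mem_strictTuples_iff hz _).2 rfl,
      rootCoeff_comp_perm _ _⟩
  refine measure_mono_null h ?_
  exact addHaar_image_eq_zero_of_differentiableOn_of_addHaar_eq_zero volume
    (differentiable_rootCoeff.restrictScalars ℝ).differentiableOn volume_not_injective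

/-- The change of variables from the coefficients of a monic polynomial to its roots. -/
theorem lintegral_roots {F : Multiset ℂ → ℝ≥0∞}
    (hF : Measurable fun z : Fin n → ℂ => F (Finset.univ.val.map z)) :
    n.factorial * ∫⁻ c : Fin n → ℂ, F (monicPoly c).roots =
      ∫⁻ z : Fin n → ℂ, ENNReal.ofReal (vandermondeSq z) * F (Finset.univ.val.map z) := by
  rw [lintegral_symmetric (H := fun z => ENNReal.ofReal (vandermondeSq z) *
    F (Finset.univ.val.map z)) (continuous_vandermondeSq.measurable.ennreal_ofReal.mul hF)
    fun z σ => by simp only [vandermondeSq_comp_perm, map_univ_comp_perm]]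
  congr 1
  have h1 := lintegral_image_eq_lintegral_abs_det_fderiv_mul volume
    (measurableSet_strictTuples (n := n)) (f := rootCoeff)
    (f' := fun z => (fderiv ℂ rootCoeff z).restrictScalars ℝ)
    (fun z _ => ((differentiable_rootCoeff z).hasFDerivAt.restrictScalars ℝ).hasFDerivWithinAt)
    (injOn_rootCoeff.mono Set.inter_subset_left) fun c => F (monicPoly c).roots
  have h2 : ∫⁻ c in rootCoeff '' strictTuples n, F (monicPoly c).roots =
      ∫⁻ c : Fin n → ℂ, F (monicPoly c).roots := by
    rw [Measure.restrict_eq_self_of_ae_mem]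
    exact volume_compl_image_strictTuples
  rw [← h2, h1]
  refine setLIntegral_congr_fun measurableSet_strictTuples fun z hz => ?_
  simp only [abs_det_fderiv_rootCoeff hz.2, roots_monicPoly_rootCoeff]

end CutoffCMV

end

/-! ### The law of the coefficients of the orthogonal polynomial. -/

noncomputable section

namespace CutoffCMV

open Polynomial

variable {n : ℕ}

/-- The real-linear map `c ↦ conj a * conj (c ∘ rev)`. -/
def revConj (n : ℕ) (a : ℂ) : (Fin n → ℂ) →ₗ[ℝ] (Fin n → ℂ) where
  toFun c i := conj a * conj (c i.rev)
  map_add' c d := by ext i; simp [mul_add]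
  map_smul' r c := by ext i; simp; ring

/-- Write R for `revConj n a`. Being conjugate-linear, R anticommutes with multiplication by i, so
1-R and 1+R are conjugate and have equal determinants. Their product is 1-R² = (1-|a|²)·1 on a real
space of dimension 2n, so the squared determinant is (1-|a|²)^{2n}. -/
theorem abs_det_one_sub_revConj {a : ℂ} (ha : ‖a‖ ≤ 1) :
    |LinearMap.det (1 - revConj n a)| = (1 - ‖a‖ ^ 2) ^ n := by
  let J : (Fin n → ℂ) →ₗ[ℝ] (Fin n → ℂ) :=
    { toFun := fun c i => Complex.I * c i
      map_add' := fun c d => by ext i; simp [mul_add]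
      map_smul' := fun r c => by ext i; simp; ring }
  have hJ : J * J = (-1 : ℝ) • (1 : (Fin n → ℂ) →ₗ[ℝ] (Fin n → ℂ)) := by
    refine LinearMap.ext fun c => funext fun i => ?_
    change Complex.I * (Complex.I * c i) = (-1 : ℝ) • c i
    rw [← mul_assoc, Complex.I_mul_I]
    simp
  have hJR : J * (1 - revConj n a) = (1 + revConj n a) * J := by
    refine LinearMap.ext fun c => funext fun i => ?_
    change Complex.I * (c i - conj a * conj (c i.rev)) =
      Complex.I * c i + conj a * conj (Complex.I * c i.rev)
    rw [map_mul, Complex.conj_I]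
    ring
  have hR : (1 - revConj n a) * (1 + revConj n a) =
      (1 - ‖a‖ ^ 2 : ℝ) • (1 : (Fin n → ℂ) →ₗ[ℝ] (Fin n → ℂ)) := by
    refine LinearMap.ext fun c => funext fun i => ?_
    change (c i + conj a * conj (c i.rev)) -
      conj a * conj (c i.rev + conj a * conj (c i.rev.rev)) = (1 - ‖a‖ ^ 2 : ℝ) • c i
    have h : conj a * a = ((‖a‖ ^ 2 : ℝ) : ℂ) := by
      rw [mul_comm, Complex.mul_conj, Complex.normSq_eq_norm_sq]
    rw [Fin.rev_rev, map_add, map_mul, Complex.conj_conj, Complex.conj_conj, Complex.real_smul,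
      Complex.ofReal_sub, ← h]
    push_cast
    ring
  have hdJ : LinearMap.det J ≠ 0 := by
    intro h
    have := congrArg LinearMap.det hJ
    rw [map_mul, h, LinearMap.det_smul, map_one] at this
    rw [zero_mul, mul_one] at this
    exact pow_ne_zero _ (by norm_num) this.symm
  have h1 := congrArg LinearMap.det hJR
  rw [map_mul, map_mul, mul_comm] at h1
  have h2 := mul_right_cancel₀ hdJ h1
  have h3 := congrArg LinearMap.det hR
  rw [map_mul, ← h2, LinearMap.det_smul, map_one, mul_one] at h3
  have h4 : Module.finrank ℝ (Fin n → ℂ) = n * 2 := by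
    simp [Module.finrank_pi_fintype]
  have h0 : 0 ≤ 1 - ‖a‖ ^ 2 := by nlinarith [norm_nonneg a]
  rw [h4, pow_mul, ← sq] at h3
  rw [← abs_of_nonneg (pow_nonneg h0 n)]
  exact sq_eq_sq_iff_abs_eq_abs _ _ |>.1 h3

/-- The linear change of variables in the Szegő recursion with fixed Verblunsky coefficient. -/
theorem lintegral_szegoStep {a : ℂ} (ha : ‖a‖ < 1) {K : (Fin (n + 1) → ℂ) → ℝ≥0∞}
    (hK : Measurable K) :
    ∫⁻ c : Fin n → ℂ, ENNReal.ofReal ((1 - ‖a‖ ^ 2) ^ n) * K (szegoStep a c) =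
      ∫⁻ c : Fin n → ℂ, K (Fin.cons (-conj a) c) := by
  have h0 : 0 < (1 - ‖a‖ ^ 2) ^ n := pow_pos (by nlinarith [norm_nonneg a]) n
  have hdet := abs_det_one_sub_revConj (n := n) ha.le
  have hne : LinearMap.det (1 - revConj n a) ≠ 0 := by
    rw [← abs_pos, hdet]; exact h0
  have hcons : Measurable fun c : Fin n → ℂ => (Fin.cons (-conj a) c : Fin (n + 1) → ℂ) := by
    refine measurable_pi_iff.2 fun i => ?_
    refine Fin.cases ?_ (fun i => ?_) i
    · simp
    · simpa using measurable_pi_apply i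
  have hKc : Measurable fun c : Fin n → ℂ => K (Fin.cons (-conj a) c) := hK.comp hcons
  have hmap := Measure.map_linearMap_addHaar_eq_smul_addHaar (volume : Measure (Fin n → ℂ)) hne
  have hLm : Measurable ⇑(1 - revConj n a : (Fin n → ℂ) →ₗ[ℝ] (Fin n → ℂ)) :=
    (LinearMap.continuous_of_finiteDimensional _).measurable
  have h1 : ∫⁻ c : Fin n → ℂ, K (szegoStep a c) =
      ENNReal.ofReal ((1 - ‖a‖ ^ 2) ^ n)⁻¹ * ∫⁻ c : Fin n → ℂ, K (Fin.cons (-conj a) c) := by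
    rw [← hdet, ← abs_inv, ← smul_eq_mul, ← lintegral_smul_measure, ← hmap,
      lintegral_map hKc hLm]
    rfl
  rw [lintegral_const_mul' _ _ ENNReal.ofReal_ne_top, h1, ← mul_assoc, ← ENNReal.ofReal_mul h0.le,
    mul_inv_cancel₀ h0.ne', ENNReal.ofReal_one, one_mul]

theorem continuous_szegoCoeff : ∀ {n : ℕ}, Continuous (szegoCoeff : (Fin n → ℂ) → Fin n → ℂ)
  | 0 => continuous_id
  | n + 1 => by
    have h1 : Continuous fun α : Fin (n + 1) → ℂ => (Fin.init α : Fin n → ℂ) :=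
      continuous_pi fun i => continuous_apply i.castSucc
    have h2 : Continuous fun α : Fin (n + 1) → ℂ => szegoCoeff (Fin.init α : Fin n → ℂ) :=
      continuous_szegoCoeff.comp h1
    refine continuous_pi fun i => ?_
    refine Fin.cases ?_ (fun i => ?_) i
    · simp only [szegoCoeff, szegoStep, Fin.cons_zero]
      fun_prop
    · simp only [szegoCoeff, szegoStep, Fin.cons_succ]
      fun_prop

theorem isDiskStable_iff_roots {c : Fin n → ℂ} :
    IsDiskStable c ↔ ∀ z ∈ (monicPoly c).roots, ‖z‖ < 1 := by
  obtain ⟨z, rfl⟩ := exists_rootCoeff_eq c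
  rw [isDiskStable_rootCoeff, roots_monicPoly_rootCoeff]
  simp

theorem pairEnergy_nonneg (s : Multiset ℂ) : 0 ≤ pairEnergy s := by
  refine Multiset.prod_nonneg fun x hx => ?_
  obtain ⟨z, _, rfl⟩ := Multiset.mem_map.1 hx
  refine Multiset.prod_nonneg fun y hy => ?_
  obtain ⟨w, _, rfl⟩ := Multiset.mem_map.1 hy
  exact norm_nonneg _

open Classical in
/-- The density of the coefficients of the orthogonal polynomial, as a function of its roots. -/
def rootDensity (n : ℕ) (β : ℝ) (s : Multiset ℂ) : ℝ≥0∞ :=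
  if ∀ z ∈ s, ‖z‖ < 1 then
    ENNReal.ofReal ((∏ k ∈ Finset.range n, (β * (k + 1) / (2 * Real.pi))) *
      pairEnergy s ^ (β / 2 - 1))
  else 0

theorem measurableSet_polydisk : MeasurableSet {z : Fin n → ℂ | ∀ i, ‖z i‖ < 1} := by
  have : {z : Fin n → ℂ | ∀ i, ‖z i‖ < 1} = ⋂ i, {z | ‖z i‖ < 1} := by ext; simp
  rw [this]
  exact MeasurableSet.iInter fun i => measurableSet_lt (measurable_pi_apply i).norm measurable_const

theorem measurable_rootDensity (m : ℕ) (β : ℝ) :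
    Measurable fun z : Fin n → ℂ => rootDensity m β (Finset.univ.val.map z) := by
  have h : (fun z : Fin n → ℂ => rootDensity m β (Finset.univ.val.map z)) =
      Set.indicator {z : Fin n → ℂ | ∀ i, ‖z i‖ < 1} fun z =>
        ENNReal.ofReal ((∏ k ∈ Finset.range m, (β * (k + 1) / (2 * Real.pi))) *
          (∏ j, ∏ k, ‖1 - z j * conj (z k)‖) ^ (β / 2 - 1)) := by
    funext z
    simp only [rootDensity, pairEnergy_map, Set.indicator_apply, Set.mem_ofPred_eq]
    simp
  rw [h]
  refine Measurable.indicator ?_ ?_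
  · refine (Measurable.const_mul (Measurable.pow_const ?_ _) _).ennreal_ofReal
    fun_prop
  · exact measurableSet_polydisk

/-- The density of `thetaLaw` for the `n`-th coefficient. -/
def thetaDensity (n : ℕ) (β : ℝ) (a : ℂ) : ℝ :=
  (β * (n + 1) + 1 - 1) / (2 * Real.pi) * (1 - ‖a‖ ^ 2) ^ ((β * (n + 1) + 1 - 3) / 2)

/-- The exponents match because β(n+1)/2 - 1 = n + (n+1)(β/2-1). The factor (1-|a|²)^n is left out
for the Jacobian of the Szegő step to absorb. -/
theorem thetaDensity_mul_rootDensity {β : ℝ} (hβ : 0 < β) {a : ℂ} (ha : ‖a‖ < 1)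
    (c : Fin n → ℂ) :
    ENNReal.ofReal (thetaDensity n β a) * rootDensity n β (monicPoly c).roots =
      ENNReal.ofReal ((1 - ‖a‖ ^ 2) ^ n) *
        rootDensity (n + 1) β (monicPoly (szegoStep a c)).roots := by
  have ht : 0 < 1 - ‖a‖ ^ 2 := by nlinarith [norm_nonneg a]
  by_cases hc : IsDiskStable c
  · rw [rootDensity, rootDensity, if_pos (isDiskStable_iff_roots.1 hc),
      if_pos (isDiskStable_iff_roots.1 ((isDiskStable_szegoStep ha).2 hc))]
    rw [← ENNReal.ofReal_mul (by rw [thetaDensity, add_sub_cancel_right]; positivity),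
      ← ENNReal.ofReal_mul (by positivity),
      pairEnergy_szegoStep ha.le, Finset.prod_range_succ,
      Real.mul_rpow (by positivity) (pairEnergy_nonneg _), thetaDensity]
    have h1 : (1 - ‖a‖ ^ 2) ^ ((β * (n + 1) + 1 - 3) / 2) =
        (1 - ‖a‖ ^ 2) ^ n * ((1 - ‖a‖ ^ 2) ^ (n + 1)) ^ (β / 2 - 1) := by
      rw [← Real.rpow_natCast _ n, ← Real.rpow_natCast _ (n + 1), ← Real.rpow_mul ht.le,
        ← Real.rpow_add ht]
      congr 1
      push_cast
      ring
    rw [h1, add_sub_cancel_right]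
    congr 1
    ring
  · rw [rootDensity, rootDensity, if_neg fun h => hc (isDiskStable_iff_roots.2 h),
      if_neg fun h => hc ((isDiskStable_szegoStep ha).1 (isDiskStable_iff_roots.2 h)), mul_zero,
      mul_zero]

theorem lintegral_pi_snoc (μ : Fin (n + 1) → Measure ℂ) [∀ i, SigmaFinite (μ i)]
    {f : (Fin (n + 1) → ℂ) → ℝ≥0∞} (hf : Measurable f) :
    ∫⁻ x, f x ∂Measure.pi μ =
      ∫⁻ a, ∫⁻ x, f (Fin.snoc x a) ∂Measure.pi (fun i : Fin n => μ i.castSucc) ∂μ (Fin.last n) := by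
  have h := (measurePreserving_piFinSuccAbove μ (Fin.last n)).symm
  rw [← h.lintegral_comp_emb (MeasurableEquiv.measurableEmbedding _), lintegral_prod]
  · simp only [Fin.succAbove_last, MeasurableEquiv.piFinSuccAbove_symm_apply,
      Fin.insertNthEquiv_last]
    rfl
  · exact (hf.comp (MeasurableEquiv.measurable _)).aemeasurable

theorem lintegral_volume_cons {f : (Fin (n + 1) → ℂ) → ℝ≥0∞} (hf : Measurable f) :
    ∫⁻ x, f x = ∫⁻ a, ∫⁻ x : Fin n → ℂ, f (Fin.cons a x) := by
  have h := (volume_preserving_piFinSuccAbove (fun _ : Fin (n + 1) => ℂ) 0).symm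
  rw [← h.lintegral_comp_emb (MeasurableEquiv.measurableEmbedding _), Measure.volume_eq_prod,
    lintegral_prod]
  · simp only [MeasurableEquiv.piFinSuccAbove_symm_apply, Fin.insertNthEquiv_zero]
    rfl
  · exact (hf.comp (MeasurableEquiv.measurable _)).aemeasurable

theorem lintegral_thetaLaw (m : ℕ) (β : ℝ) (f : ℂ → ℝ≥0∞) :
    ∫⁻ a, f a ∂thetaLaw (β * (m + 1) + 1) =
      ∫⁻ a in Metric.ball 0 1, ENNReal.ofReal (thetaDensity m β a) * f a := by
  rw [thetaLaw, lintegral_withDensity_eq_lintegral_mul_non_measurable]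
  · rfl
  · refine (Measurable.const_mul (Measurable.pow_const ?_ _) _).ennreal_ofReal
    fun_prop
  · exact Filter.Eventually.of_forall fun _ => ENNReal.ofReal_lt_top

instance (ν : ℝ) : SigmaFinite (thetaLaw ν) := by
  unfold thetaLaw
  infer_instance

theorem measurePreserving_neg_conj : MeasurePreserving (fun a : ℂ => -conj a) :=
  (Complex.conjLIE.trans (LinearIsometryEquiv.neg ℝ)).measurePreserving

theorem measurableEmbedding_neg_conj : MeasurableEmbedding (fun a : ℂ => -conj a) :=
  (Complex.conjLIE.trans (LinearIsometryEquiv.neg ℝ)).toHomeomorph.measurableEmbedding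

/-- The law of the coefficients of the orthogonal polynomial. -/
theorem lintegral_szegoCoeff {β : ℝ} (hβ : 0 < β) : ∀ {n : ℕ} {G : (Fin n → ℂ) → ℝ≥0∞},
    Measurable G →
    ∫⁻ α, G (szegoCoeff α) ∂Measure.pi (fun k : Fin n => thetaLaw (β * ((k : ℕ) + 1) + 1)) =
      ∫⁻ c : Fin n → ℂ, rootDensity n β (monicPoly c).roots * G c
  | 0, G, hG => by
    rw [volume_pi, Measure.pi_of_empty _ 0, Measure.pi_of_empty _ 0, lintegral_dirac,
      lintegral_dirac]
    simp [szegoCoeff, rootDensity, monicPoly, pairEnergy]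
  | n + 1, G, hG => by
    set K : (Fin (n + 1) → ℂ) → ℝ≥0∞ := fun c => rootDensity (n + 1) β (monicPoly c).roots * G c
      with hKdef
    have hK : Measurable K := (measurable_roots (measurable_rootDensity _ _)).mul hG
    rw [lintegral_pi_snoc _ (f := fun α => G (szegoCoeff α))
      (hG.comp continuous_szegoCoeff.measurable)]
    have hstep : ∀ a : ℂ, Measurable fun c : Fin n → ℂ => G (szegoStep a c) := by
      intro a
      refine hG.comp (measurable_pi_iff.2 fun i => ?_)
      refine Fin.cases ?_ (fun i => ?_) i
      · simp [szegoStep]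
      · simp only [szegoStep, Fin.cons_succ]
        fun_prop
    have h1 : ∀ a : ℂ, ∫⁻ x, G (szegoCoeff (Fin.snoc x a : Fin (n + 1) → ℂ)) ∂Measure.pi
        (fun k : Fin n => thetaLaw (β * ((k.castSucc : ℕ) + 1) + 1)) =
        ∫⁻ c : Fin n → ℂ, rootDensity n β (monicPoly c).roots * G (szegoStep a c) := by
      intro a
      simp only [szegoCoeff, Fin.snoc_last, Fin.init_snoc, Fin.val_castSucc]
      exact lintegral_szegoCoeff hβ (hstep a)
    simp only [h1, Fin.val_last]
    rw [lintegral_thetaLaw]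
    have h2 : ∀ a ∈ Metric.ball (0 : ℂ) 1, ENNReal.ofReal (thetaDensity n β a) *
        ∫⁻ c : Fin n → ℂ, rootDensity n β (monicPoly c).roots * G (szegoStep a c) =
        ∫⁻ c : Fin n → ℂ, K (Fin.cons (-conj a) c) := by
      intro a ha
      have ha' : ‖a‖ < 1 := by simpa using ha
      rw [← lintegral_szegoStep ha' hK, ← lintegral_const_mul' _ _ ENNReal.ofReal_ne_top]
      refine lintegral_congr fun c => ?_
      rw [← mul_assoc, thetaDensity_mul_rootDensity hβ ha', mul_assoc]
    -- The new constant coefficient is -conj(a), so a ↦ -conj(a), an isometry preserving the disk,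
    -- turns a into that coordinate.
    rw [setLIntegral_congr_fun measurableSet_ball h2, lintegral_volume_cons hK,
      ← measurePreserving_neg_conj.lintegral_comp_emb measurableEmbedding_neg_conj]
    rw [← lintegral_indicator measurableSet_ball]
    refine lintegral_congr fun a => ?_
    by_cases ha : a ∈ Metric.ball (0 : ℂ) 1
    · rw [Set.indicator_of_mem ha]
    · rw [Set.indicator_of_notMem ha]
      refine (lintegral_eq_zero_of_ae_eq_zero (Filter.Eventually.of_forall fun c => ?_)).symm
      -- Off the disk nothing is lost: the constant coefficient is, up to sign, the product of the
      -- roots, so a stable polynomial has it of modulus < 1.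
      have hns : ¬ IsDiskStable (Fin.cons (-conj a) c : Fin (n + 1) → ℂ) := fun h => ha (by
        simpa using h.norm_coeff_zero_lt)
      simp only [hKdef, rootDensity, if_neg fun h => hns (isDiskStable_iff_roots.2 h), zero_mul,
        Pi.zero_apply]

end CutoffCMV

end

/-! ### The joint law of the eigenvalues. -/

noncomputable section

namespace CutoffCMV

variable {n : ℕ}

theorem measurable_jointDensity (β : ℝ) : Measurable (jointDensity n β) := by
  unfold jointDensity interaction
  fun_prop

theorem jointDensity_comp_perm (β : ℝ) (z : Fin n → ℂ) (σ : Equiv.Perm (Fin n)) :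
    jointDensity n β (z ∘ σ) = jointDensity n β z := by
  have h1 : interaction β (z ∘ σ) = interaction β z := by
    simp only [interaction, Function.comp]
    rw [Equiv.prod_comp σ fun j => ∏ k, (1 - z j * conj (z (σ k))) ^ ((β / 2 - 1 : ℝ) : ℂ)]
    refine Finset.prod_congr rfl fun j _ => ?_
    exact Equiv.prod_comp σ fun k => (1 - z j * conj (z k)) ^ ((β / 2 - 1 : ℝ) : ℂ)
  have h2 := vandermondeSq_comp_perm z σ
  simp only [vandermondeSq] at h2
  rw [jointDensity, jointDensity, h1, h2]

theorem jointLaw_map_comp_perm (β : ℝ) (σ : Equiv.Perm (Fin n)) :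
    (jointLaw n β).map (fun z => z ∘ σ) = jointLaw n β := by
  have hσ := measurePreserving_comp_perm σ
  have hD := measurableSet_polydisk (n := n)
  have hm := (measurable_jointDensity (n := n) β).ennreal_ofReal
  rw [jointLaw, ← withDensity_indicator hD]
  set g := Set.indicator {z : Fin n → ℂ | ∀ i, ‖z i‖ < 1}
    fun z => ENNReal.ofReal (jointDensity n β z) with hg
  have hgm : Measurable g := hm.indicator hD
  have hgσ : ∀ z, g (z ∘ σ) = g z := by
    intro z
    have h : z ∘ σ ∈ {z : Fin n → ℂ | ∀ i, ‖z i‖ < 1} ↔ z ∈ {z : Fin n → ℂ | ∀ i, ‖z i‖ < 1} :=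
      σ.forall_congr_left (p := fun i => ‖z (σ i)‖ < 1) |>.trans (by simp)
    by_cases hz : z ∈ {z : Fin n → ℂ | ∀ i, ‖z i‖ < 1}
    · rw [hg, Set.indicator_of_mem hz, Set.indicator_of_mem (h.2 hz), jointDensity_comp_perm]
    · rw [hg, Set.indicator_of_notMem hz, Set.indicator_of_notMem fun h' => hz (h.1 h')]
  ext s hs
  rw [Measure.map_apply hσ.measurable hs, withDensity_apply _ (hσ.measurable hs),
    withDensity_apply _ hs, ← hσ.setLIntegral_comp_preimage hs hgm]
  simp only [hgσ]

theorem vandermondeSq_mul_rootDensity (β : ℝ) (z : Fin n → ℂ) :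
    ENNReal.ofReal (vandermondeSq z) * rootDensity n β (Finset.univ.val.map z) =
      n.factorial * Set.indicator {z : Fin n → ℂ | ∀ i, ‖z i‖ < 1}
        (fun z => ENNReal.ofReal (jointDensity n β z)) z := by
  by_cases hz : ∀ i, ‖z i‖ < 1
  · have hz' : ∀ w ∈ Finset.univ.val.map z, ‖w‖ < 1 := by simpa using hz
    rw [Set.indicator_of_mem (by exact hz), rootDensity, if_pos hz', jointDensity,
      (interaction_eq_ofReal β z hz).1, Complex.ofReal_re, pairEnergy_map,
      ← ENNReal.ofReal_natCast, ← ENNReal.ofReal_mul (by unfold vandermondeSq; positivity),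
      ← ENNReal.ofReal_mul (by positivity)]
    congr 1
    -- The factors k+1 of the normalising constants multiply to n!, the number of orderings of the
    -- roots.
    have h1 : ∏ k ∈ Finset.range n, (β * ((k : ℝ) + 1) / (2 * Real.pi)) =
        n.factorial * (β ^ n / (2 * Real.pi) ^ n) := by
      have h2 : ((n.factorial : ℕ) : ℝ) = ∏ k ∈ Finset.range n, ((k : ℝ) + 1) := by
        rw [← Finset.prod_range_add_one_eq_factorial]
        push_cast
        rfl
      rw [h2, Finset.prod_div_distrib, Finset.prod_mul_distrib]
      simp
      ring
    rw [h1, ← Real.finsetProd_rpow _ _ fun j _ => Finset.prod_nonneg fun k _ => norm_nonneg _]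
    simp only [← Real.finsetProd_rpow _ _ fun k _ => norm_nonneg _]
    rw [vandermondeSq]
    ring
  · have hz' : ¬ ∀ w ∈ Finset.univ.val.map z, ‖w‖ < 1 := by simpa using hz
    rw [Set.indicator_of_notMem (by exact hz), rootDensity, if_neg hz', mul_zero, mul_zero]

theorem lintegral_rootDensity (β : ℝ) {F : Multiset ℂ → ℝ≥0∞}
    (hF : Measurable fun z : Fin n → ℂ => F (Finset.univ.val.map z)) :
    ∫⁻ c : Fin n → ℂ, rootDensity n β (monicPoly c).roots * F (monicPoly c).roots =
      ∫⁻ z : Fin n → ℂ, F (Finset.univ.val.map z) ∂jointLaw n β := by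
  have h := lintegral_roots (F := fun s => rootDensity n β s * F s)
    ((measurable_rootDensity n β).mul hF)
  have hm := (measurable_jointDensity (n := n) β).ennreal_ofReal
  simp only [← mul_assoc, vandermondeSq_mul_rootDensity] at h
  simp only [mul_assoc] at h
  rw [lintegral_const_mul' _ _ (ENNReal.natCast_ne_top _)] at h
  have h0 : (n.factorial : ℝ≥0∞) ≠ 0 := by exact_mod_cast n.factorial_ne_zero
  rw [(ENNReal.mul_right_inj h0 (ENNReal.natCast_ne_top _)).1 h, jointLaw,
    ← withDensity_indicator measurableSet_polydisk,
    lintegral_withDensity_eq_lintegral_mul _ (hm.indicator measurableSet_polydisk) hF]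
  rfl

end CutoffCMV

end

open CutoffCMV in
theorem mainTheorem2 {Ω : Type*} [MeasurableSpace Ω] (P : Measure Ω) [IsProbabilityMeasure P]
    (n : ℕ) (β : ℝ) (hβ : 0 < β) (α : Fin n → Ω → ℂ)
    (hlaw : ∀ k : Fin n, HasLaw (α k) (CutoffCMV.thetaLaw (β * ((k : ℕ) + 1) + 1)) P)
    (hindep : iIndepFun α P) :
    CutoffCMV.HasJointEigenvalueLaw P (fun ω => CutoffCMV.cmv fun k => α k ω)
      (CutoffCMV.jointLaw n β) := by
  refine ⟨jointLaw_map_comp_perm β, fun F hF => ?_⟩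
  have hα : ∀ k, AEMeasurable (α k) P := fun k => (hlaw k).aemeasurable
  have hαm : AEMeasurable (fun ω k => α k ω) P := aemeasurable_pi_lambda _ hα
  have hmap : P.map (fun ω k => α k ω) =
      Measure.pi fun k : Fin n => thetaLaw (β * ((k : ℕ) + 1) + 1) := by
    rw [(iIndepFun_iff_map_fun_eq_pi_map hα).1 hindep]
    congr 1
    funext k
    exact (hlaw k).map_eq
  have hG : Measurable fun a : Fin n → ℂ => F (monicPoly (szegoCoeff a)).roots :=
    (measurable_roots hF).comp continuous_szegoCoeff.measurable
  -- Needed for `charpoly_cmv`: `Real.sqrt` gives ρ² = 1-|α|² only when |α| ≤ 1, which holds almost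
  -- surely.
  have hdisk : ∀ k, ∀ᵐ ω ∂P, ‖α k ω‖ ≤ 1 := by
    intro k
    refine ae_of_ae_map (p := fun z : ℂ => ‖z‖ ≤ 1) (hα k) ?_
    rw [(hlaw k).map_eq, thetaLaw]
    refine (withDensity_absolutelyContinuous _ _).ae_le ?_
    filter_upwards [ae_restrict_mem measurableSet_ball] with z hz
    have : ‖z‖ < 1 := by simpa using hz
    exact this.le
  have hae : (fun ω => F (cmv fun k => α k ω).charpoly.roots) =ᵐ[P]
      fun ω => F (monicPoly (szegoCoeff fun k => α k ω)).roots := by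
    filter_upwards [ae_all_iff.2 hdisk] with ω hω
    rw [charpoly_cmv _ hω]
  refine ⟨(hG.comp_aemeasurable hαm).congr hae.symm, ?_⟩
  rw [lintegral_congr_ae hae, ← lintegral_rootDensity β hF,
    ← lintegral_szegoCoeff hβ (measurable_roots hF), ← hmap, lintegral_map' hG.aemeasurable hαm]
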